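/- **Lemma (constant regret of D-UCB with full information).** *Setting.* Let $\mathcal X,\mathcal V$ be finite sets, $p$ a probability distribution on $\mathcal X$ (contexts), $\pi_1,\dots,\pi_N$ experts, i.e. conditional distributions $\pi_i(\cdot|x)$ on $\mathcal V$ with $\pi_i(v|x)>0$ for all $i,x,v$, and $q(\cdot|x,v)$ reward distributions on $[0,1]$. In round $t=1,2,\dots$ an expert $k_t$ is chosen from the past; then $X_t\sim p$, $V_t\sim\pi_{k_t}(\cdot|X_t)$, $Y_t\sim q(\cdot|X_t,V_t)$ are drawn and observed. Let $\mu_i$ be the mean reward of expert $i$ (under $p(x)\pi_i(v|x)q(y|x,v)$), $\mu^*=\max_i\mu_i$, $\Delta_i=\mu^*-\mu_i$, and assume $0<\gamma\le\min_i\mu_i$. Put $r_{ij}(v|x)=\pi_i(v|x)/\pi_j(v|x)$, $f_1(z)=z e^{z-1}-1$, $$D_{f_1}(i\|j)=\sum_x p(x)\sum_v\pi_i(v|x)f_1(r_{ij}(v|x)),\qquad M_{ij}=1+\log(1+D_{f_1}(i\|j)),$$ let $M\ge\max_{i,j}M_{ij}$, and let $C\ge 32M/\gamma$. For $x>0$ let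 $w(x)$ be the unique $y\in(0,2)$ with $y/\log(2/y)=x$, and $w(0)=0$. For $t\ge1$ let $Z_i(t)=\sum_{s\le t}M_{ik_s}^{-1}$, $\epsilon_i(t)=C\,w\big(\sqrt{t\log t}/Z_i(t)\big)$, $$\hat Y_i(t)=\frac1{Z_i(t)}\sum_{s=1}^t\frac{Y_s}{M_{ik_s}}\,r_{ik_s}(V_s|X_s)\,\mathbf 1\Big\{r_{ik_s}(V_s|X_s)\le 2\log\tfrac{2}{\epsilon_i(t)}\,M_{ik_s}\Big\},\qquad U_i(t)=\hat Y_i(t)+\tfrac32\epsilon_i(t)$$ (no clipping if $\epsilon_i(t)=0$). D-UCB plays an arbitrary expert in round $1$ and, in round $t+1$ for $t\ge1$, an expert $k_{t+1}\in\arg\max_iU_i(t)$, ties being broken arbitrarily (possibly at random, but independently of $X_{t+1}$ given the past). For every suboptimal expert $k$ (that is, $\Delta_k>0$) define $$\tau_1=\min\{t\ge2: C\,w(\sqrt{\log t/t})\le\gamma\},\quad \tau_k=\min\Big\{t\ge 2:\frac{t}{\log t}\ge\frac{9C^2M^2\log^2(6C/\Delta_k)}{\Delta_k^2}\Big\},\quad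 T_k=\max\{\tau_1,\tau_k\}$$ (the $\tau_1$ in $T_k$ is always this first quantity). *Claim.* 1. For every suboptimal expert $k$ and every $t\ge T_k$, $\ \mathbb P(U_k(t)<\mu^*)\ge 1-\dfrac1{t^2}$. 2. For every horizon $T$, the expected regret $\mathbb E[R(T)]=\mathbb E\big[\sum_{t=1}^T(\mu^*-\mu_{k_t})\big]$ satisfies $$\mathbb E[R(T)]\le\sum_{k:\Delta_k>0}\Delta_k\Big(T_k+\frac{\pi^2}{3}\Big)\quad\text{and hence}\quad \mathbb E[R(T)]\le C_2N,\qquad C_2=\max_{k}\Delta_k\Big(T_k+\frac{\pi^2}3\Big)$$ (optimal experts contribute $0$ to the maximum), where $C_2$ does not depend on $T$. -/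

import Mathlib

open MeasureTheory

noncomputable section

/-- A contextual bandit instance with `N` stochastic experts over finite context and action sets.
`p` is the context distribution, `policy i x v = π_i(v|x)` is the probability that expert `i`
recommends action `v` in context `x`, and `q x v` is the law of the reward, which lies in `[0,1]`.
Every expert gives positive probability to every action in every context. -/
structure ExpertBandit (N : ℕ) (𝒳 𝒱 : Type*) [Fintype 𝒳] [Fintype 𝒱] where
  p : 𝒳 → ℝ
  p_nonneg : ∀ x, 0 ≤ p x
  p_sum : ∑ x, p x = 1
  policy : Fin N → 𝒳 → 𝒱 → ℝ
  policy_pos : ∀ i x v, 0 < policy i x v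
  policy_sum : ∀ i x, ∑ v, policy i x v = 1
  q : 𝒳 → 𝒱 → Measure ℝ
  q_prob : ∀ x v, IsProbabilityMeasure (q x v)
  q_supp : ∀ x v, q x v (Set.Icc 0 1)ᶜ = 0

/-- What is recorded in one round: (expert played, context, action, reward). -/
abbrev Round (N : ℕ) (𝒳 𝒱 : Type*) := Fin N × 𝒳 × 𝒱 × ℝ

/-- The generator `f₁(x) = x exp(x - 1) - 1`. -/
def genF (x : ℝ) : ℝ := x * Real.exp (x - 1) - 1

open Classical in
/-- For `x > 0`, `clipW x` is the unique `y ∈ (0, 2)` with `y / log (2 / y) = x`;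
`clipW 0 = 0` is the limiting value. -/
def clipW (x : ℝ) : ℝ :=
  if h : ∃ y ∈ Set.Ioo (0 : ℝ) 2, y / Real.log (2 / y) = x then h.choose else 0

theorem clipW_wellDefined {x : ℝ} (hx : 0 < x) :
    ∃! y : ℝ, y ∈ Set.Ioo (0 : ℝ) 2 ∧ y / Real.log (2 / y) = x := by
  have hlog : ∀ y ∈ Set.Ioo (0 : ℝ) 2, 0 < Real.log (2 / y) := fun y hy =>
    Real.log_pos (by rw [lt_div_iff₀ hy.1]; linarith [hy.2])
  have key : ∀ y ∈ Set.Ioo (0 : ℝ) 2,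
      (y / Real.log (2 / y) = x ↔ y - x * (Real.log 2 - Real.log y) = 0) := fun y hy => by
    rw [div_eq_iff (hlog y hy).ne', Real.log_div two_ne_zero hy.1.ne', sub_eq_zero]
  have mono : ∀ y z : ℝ, 0 < y → y < z →
      y - x * (Real.log 2 - Real.log y) < z - x * (Real.log 2 - Real.log z) := by
    intro y z hy hyz
    have := mul_lt_mul_of_pos_left (Real.log_lt_log hy hyz) hx
    linarith
  set a : ℝ := 2 * Real.exp (-(2 / x)) with ha
  have ha0 : 0 < a := by positivity
  have he : Real.exp (-(2 / x)) < 1 := by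
    rw [← Real.exp_zero]
    exact Real.exp_lt_exp.2 (neg_lt_zero.2 (by positivity))
  have ha2 : a < 2 := by linarith
  have hla : Real.log a = Real.log 2 - 2 / x := by
    rw [ha, Real.log_mul two_ne_zero (Real.exp_pos _).ne', Real.log_exp]; ring
  have hcont : ContinuousOn (fun y => y - x * (Real.log 2 - Real.log y)) (Set.Icc a 2) := by
    refine continuousOn_id.sub (continuousOn_const.mul (continuousOn_const.sub ?_))
    exact Real.continuousOn_log.mono fun y hy => (lt_of_lt_of_le ha0 hy.1).ne'
  have hmem : (0 : ℝ) ∈ Set.Ioo ((fun y => y - x * (Real.log 2 - Real.log y)) a)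
      ((fun y => y - x * (Real.log 2 - Real.log y)) 2) := by
    constructor
    · have : x * (2 / x) = 2 := by field_simp
      simp only [hla]
      linarith [show x * (Real.log 2 - (Real.log 2 - 2 / x)) = x * (2 / x) by ring]
    · simp
  obtain ⟨y, hy, hy0⟩ := intermediate_value_Ioo ha2.le hcont hmem
  have hyI : y ∈ Set.Ioo (0 : ℝ) 2 := ⟨ha0.trans hy.1, hy.2⟩
  refine ⟨y, ⟨hyI, (key y hyI).2 hy0⟩, ?_⟩
  rintro z ⟨hz, hzx⟩
  have hz0 := (key z hz).1 hzx
  simp only at hy0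
  rcases lt_trichotomy z y with h | h | h
  · linarith [mono z y hz.1 h]
  · exact h
  · linarith [mono y z hyI.1 h]

theorem clipW_spec {x : ℝ} (hx : 0 < x) :
    clipW x ∈ Set.Ioo (0 : ℝ) 2 ∧ clipW x / Real.log (2 / clipW x) = x := by
  have h : ∃ y ∈ Set.Ioo (0 : ℝ) 2, y / Real.log (2 / y) = x := (clipW_wellDefined hx).exists
  simp only [clipW, dif_pos h]
  exact h.choose_spec

/-- `τ₁`, the first time at which `C w(√(log t / t)) ≤ γ`. -/
def tauBest (C γ : ℝ) : ℕ :=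
  sInf {t : ℕ | 2 ≤ t ∧ C * clipW (√(Real.log t / t)) ≤ γ}

/-- `τ(Δ)`, the first time at which `t / log t ≥ 9 C² M² log²(6C/Δ) / Δ²`. -/
def tauSub (C M Δ : ℝ) : ℕ :=
  sInf {t : ℕ | 2 ≤ t ∧
    9 * C ^ 2 * M ^ 2 * Real.log (6 * C / Δ) ^ 2 / Δ ^ 2 ≤ (t : ℝ) / Real.log t}

namespace ExpertBandit

variable {N : ℕ} {𝒳 𝒱 : Type*} [Fintype 𝒳] [Fintype 𝒱]

/-- The mean reward `μ_i` of expert `i` under `p(x) π_i(v|x) q(y|x,v)`. -/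
def mean (E : ExpertBandit N 𝒳 𝒱) (i : Fin N) : ℝ :=
  ∑ x, E.p x * ∑ v, E.policy i x v * ∫ y, y ∂(E.q x v)

/-- `μ* = max_i μ_i`. -/
def bestMean (E : ExpertBandit N 𝒳 𝒱) : ℝ := ⨆ i, E.mean i

/-- The suboptimality gap `Δ_i = μ* - μ_i`. -/
def gap (E : ExpertBandit N 𝒳 𝒱) (i : Fin N) : ℝ := E.bestMean - E.mean i

/-- The importance sampling ratio `r_ij(v|x) = π_i(v|x) / π_j(v|x)`. -/
def ratio (E : ExpertBandit N 𝒳 𝒱) (i j : Fin N) (x : 𝒳) (v : 𝒱) : ℝ :=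
  E.policy i x v / E.policy j x v

/-- The divergence `D_{f₁}(i‖j)` between experts. -/
def fDiv (E : ExpertBandit N 𝒳 𝒱) (i j : Fin N) : ℝ :=
  ∑ x, E.p x * ∑ v, E.policy i x v * genF (E.ratio i j x v)

/-- `M_ij = 1 + log (1 + D_{f₁}(i‖j))`. -/
def logDiv (E : ExpertBandit N 𝒳 𝒱) (i j : Fin N) : ℝ := 1 + Real.log (1 + E.fDiv i j)

/-- `Z_i(t) = ∑ 1 / M_{i k_s}`, summed over the first `t` rounds of the trajectory `h`. -/
def normalizer (E : ExpertBandit N 𝒳 𝒱) (i : Fin N) (t : ℕ) (h : ℕ → Round N 𝒳 𝒱) : ℝ :=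
  ∑ s ∈ Finset.range t, 1 / E.logDiv i (h s).1

/-- `ε_i(t) = C w(√(t log t) / Z_i(t))`. -/
def eps (E : ExpertBandit N 𝒳 𝒱) (C : ℝ) (i : Fin N) (t : ℕ) (h : ℕ → Round N 𝒳 𝒱) : ℝ :=
  C * clipW (√(t * Real.log t) / E.normalizer i t h)

open Classical in
/-- The clipped importance sampling estimate of `μ_i` from the first `t` rounds. For `ε_i(t) = 0`
(which happens at `t = 1`) the clipping level `2 log(2/ε) M` is `+∞`: nothing is clipped. -/
def estimate (E : ExpertBandit N 𝒳 𝒱) (C : ℝ) (i : Fin N) (t : ℕ) (h : ℕ → Round N 𝒳 𝒱) : ℝ :=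
  (1 / E.normalizer i t h) * ∑ s ∈ Finset.range t,
    if E.eps C i t h = 0 ∨ E.ratio i (h s).1 (h s).2.1 (h s).2.2.1
        ≤ 2 * Real.log (2 / E.eps C i t h) * E.logDiv i (h s).1
    then (h s).2.2.2 / E.logDiv i (h s).1 * E.ratio i (h s).1 (h s).2.1 (h s).2.2.1
    else 0

/-- The D-UCB index `U_i(t)` of expert `i` after the first `t` rounds. -/
def ucb (E : ExpertBandit N 𝒳 𝒱) (C : ℝ) (i : Fin N) (t : ℕ) (h : ℕ → Round N 𝒳 𝒱) : ℝ :=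
  E.estimate C i t h + 3 / 2 * E.eps C i t h

/-- The process `H` (round `t + 1` of the play is `H t`) is a run of D-UCB with constant `C` on the
instance `E`. Given the past and the expert `i` chosen for the round, the context, action and reward
of the round have law `p(x) π_i(v|x) q(dy|x,v)`; the expert chosen after `t ≥ 1` rounds maximises the
index `U(t)`, with arbitrary (possibly random) choice in the first round and among ties. -/
structure IsDUCBRun [MeasurableSpace 𝒳] [MeasurableSpace 𝒱] (E : ExpertBandit N 𝒳 𝒱) (C : ℝ)
    {Ω : Type*} [MeasurableSpace Ω] (P : Measure Ω) (H : ℕ → Ω → Round N 𝒳 𝒱) : Prop where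
  measurable : ∀ t, Measurable (H t)
  law : ∀ (t : ℕ) (A : Set (Fin t → Round N 𝒳 𝒱)) (i : Fin N) (x : 𝒳) (v : 𝒱) (B : Set ℝ),
    MeasurableSet A → MeasurableSet B →
    P {ω | (fun s : Fin t => H s ω) ∈ A ∧ (H t ω).1 = i ∧
        (H t ω).2.1 = x ∧ (H t ω).2.2.1 = v ∧ (H t ω).2.2.2 ∈ B}
      = P {ω | (fun s : Fin t => H s ω) ∈ A ∧ (H t ω).1 = i}
        * (ENNReal.ofReal (E.p x * E.policy i x v) * E.q x v B)
  choice : ∀ t : ℕ, 1 ≤ t →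
    ∀ᵐ ω ∂P, ∀ j, E.ucb C j t (fun s => H s ω) ≤ E.ucb C (H t ω).1 t (fun s => H s ω)

/-- `T_k = max {T₁, τ_k}`. -/
def burnIn (E : ExpertBandit N 𝒳 𝒱) (C M γ : ℝ) (k : Fin N) : ℕ :=
  max (tauBest C γ) (tauSub C M (E.gap k))

/-- The cumulative regret `∑ (μ* - μ_{k_t})` of the first `T` rounds of a trajectory. -/
def regret (E : ExpertBandit N 𝒳 𝒱) (T : ℕ) (h : ℕ → Round N 𝒳 𝒱) : ℝ :=
  ∑ s ∈ Finset.range T, (E.bestMean - E.mean (h s).1)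

/-- The horizon-independent constant `C₂ = max_k Δ_k (T_k + π²/3)`
(optimal experts contribute `0`). -/
def regretConst (E : ExpertBandit N 𝒳 𝒱) (C M γ : ℝ) : ℝ :=
  ⨆ k, E.gap k * (E.burnIn C M γ k + Real.pi ^ 2 / 3)

end ExpertBandit

end

set_option linter.unusedSectionVars false

/-! The index of an expert is a clipped importance-sampling mean plus a bonus, and two errors must
be compared with `ε = ε_i(t)`. Bias: `1 + D_{f₁}(i‖j)` is the mean of `r e^{r-1}` under expert `i`,
so by Markov's inequality clipping at `2 a M_ij` loses at most `e^{-a} / 2` (`ratio_tail_le`), which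
is `O(ε)` at `a = log (2 / ε)`. Fluctuation: gains clipped at level `a` lie in `[0, 2a]` and become
martingale differences once centred, so Hoeffding's lemma and a Chernoff bound control their sum up
to a multiple of `a √(t log t)`; the equation defining `w` makes this at most a fraction of `ε
Z_i(t)` (`level_le`).

The obstacle is that `log (2 / ε)` depends on the trajectory, so the gains clipped there are not
martingale differences. Gains are monotone in the clipping level, however, so it suffices to control
the integer levels `1, …, t` by a union bound (`measure_deviationEvent_le`) and to round the true
level up for an upper bound and down for a lower one.

Off the deviation event the rest is deterministic: the index dominates the mean (`mean_le_ucb`), and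
after the burn-in, where `ε ≤ Δ_k / 3`, the index of a suboptimal `k` stays below `μ*`
(`ucb_lt_bestMean`). Playing `k` then requires a large deviation for `k` or for a best expert, of
probability at most `2 / t²`, and these sum to `π² / 3`. -/

theorem two_mul_sub_one_le_genF {z : ℝ} (hz : 0 ≤ z) : 2 * (z - 1) ≤ genF z := by
  have h1 : z ≤ Real.exp (z - 1) := by linarith [Real.add_one_le_exp (z - 1)]
  have h2 : z * z ≤ z * Real.exp (z - 1) := mul_le_mul_of_nonneg_left h1 hz
  unfold genF
  nlinarith [sq_nonneg (z - 1)]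

/-! ### Divergences, clipping bias and mean clipped gains -/

namespace ExpertBandit

variable {N : ℕ} {𝒳 𝒱 : Type*} [Fintype 𝒳] [Fintype 𝒱] (E : ExpertBandit N 𝒳 𝒱)

theorem ratio_pos (i j : Fin N) (x : 𝒳) (v : 𝒱) : 0 < E.ratio i j x v :=
  div_pos (E.policy_pos i x v) (E.policy_pos j x v)

theorem fDiv_nonneg (i j : Fin N) : 0 ≤ E.fDiv i j := by
  refine Finset.sum_nonneg fun x _ => mul_nonneg (E.p_nonneg x) ?_
  -- The tangent line of `genF` at `1`, weighted by `π_i`, is `2 (π_i - π_j)` plus a nonnegative χ²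
  -- term; without that term the sum over `v` vanishes.
  have h : ∀ v ∈ Finset.univ, 2 * (E.policy i x v - E.policy j x v) ≤
      E.policy i x v * genF (E.ratio i j x v) := by
    intro v _
    have hi := E.policy_pos i x v
    have hj := E.policy_pos j x v
    refine le_trans ?_ (mul_le_mul_of_nonneg_left
      (two_mul_sub_one_le_genF (E.ratio_pos i j x v).le) hi.le)
    have : E.policy i x v * (2 * (E.ratio i j x v - 1)) =
        2 * (E.policy i x v - E.policy j x v)
          + 2 * ((E.policy i x v - E.policy j x v) ^ 2 / E.policy j x v) := by
      unfold ratio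
      field_simp
      ring
    rw [this]
    have : 0 ≤ (E.policy i x v - E.policy j x v) ^ 2 / E.policy j x v := by positivity
    linarith
  have := Finset.sum_le_sum h
  rwa [← Finset.mul_sum, Finset.sum_sub_distrib, E.policy_sum, E.policy_sum, sub_self,
    mul_zero] at this

theorem one_le_logDiv (i j : Fin N) : 1 ≤ E.logDiv i j := by
  have := Real.log_nonneg (show 1 ≤ 1 + E.fDiv i j by linarith [E.fDiv_nonneg i j])
  unfold logDiv
  linarith

theorem logDiv_pos (i j : Fin N) : 0 < E.logDiv i j := one_pos.trans_le (E.one_le_logDiv i j)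

theorem exp_logDiv_sub_one (i j : Fin N) : Real.exp (E.logDiv i j - 1) = 1 + E.fDiv i j := by
  rw [logDiv, add_sub_cancel_left, Real.exp_log (by linarith [E.fDiv_nonneg i j])]

theorem one_add_fDiv (i j : Fin N) :
    1 + E.fDiv i j = ∑ x, E.p x * ∑ v, E.policy i x v *
      (E.ratio i j x v * Real.exp (E.ratio i j x v - 1)) := by
  have h : ∀ x, ∑ v, E.policy i x v * genF (E.ratio i j x v) =
      ∑ v, E.policy i x v * (E.ratio i j x v * Real.exp (E.ratio i j x v - 1)) - 1 := by
    intro x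
    simp only [genF, mul_sub, mul_one, Finset.sum_sub_distrib, E.policy_sum]
  simp only [fDiv, h, mul_sub, mul_one, Finset.sum_sub_distrib, E.p_sum]
  ring

/-- Under expert `i`, the importance ratio exceeds `2 a M_ij` with probability at most
`exp (-a) / 2`. -/
theorem ratio_tail_le (i j : Fin N) {a : ℝ} (ha : 1 ≤ a) :
    ∑ x, E.p x * ∑ v, E.policy i x v *
      (if E.ratio i j x v ≤ 2 * a * E.logDiv i j then 0 else 1) ≤ Real.exp (-a) / 2 := by
  set L := E.logDiv i j with hL
  have hL1 : 1 ≤ L := E.one_le_logDiv i j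
  set b := 2 * a * L with hb
  have hb2 : 2 ≤ b := by nlinarith
  -- Markov's inequality: where the ratio exceeds `b`, the integrand of `one_add_fDiv` is at least
  -- `b e^{b-1}`.
  have h1 : (∑ x, E.p x * ∑ v, E.policy i x v *
      (if E.ratio i j x v ≤ b then 0 else 1)) * (b * Real.exp (b - 1)) ≤ Real.exp (L - 1) := by
    rw [hL, E.exp_logDiv_sub_one, E.one_add_fDiv, Finset.sum_mul]
    refine Finset.sum_le_sum fun x _ => ?_
    rw [mul_assoc, Finset.sum_mul]
    refine mul_le_mul_of_nonneg_left (Finset.sum_le_sum fun v _ => ?_) (E.p_nonneg x)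
    rw [mul_assoc]
    refine mul_le_mul_of_nonneg_left ?_ (E.policy_pos i x v).le
    have hr := E.ratio_pos i j x v
    split_ifs with h
    · rw [zero_mul]; positivity
    · rw [one_mul]
      push Not at h
      gcongr
  set S := ∑ x, E.p x * ∑ v, E.policy i x v * (if E.ratio i j x v ≤ b then (0 : ℝ) else 1)
  have hS : 0 ≤ S := Finset.sum_nonneg fun x _ => mul_nonneg (E.p_nonneg x)
    (Finset.sum_nonneg fun v _ => mul_nonneg (E.policy_pos i x v).le (by split_ifs <;> norm_num))
  -- Amounts to `a + L ≤ 2 a L`, valid since `a, L ≥ 1`.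
  have h2 : Real.exp (L - 1) ≤ Real.exp (-a) * Real.exp (b - 1) := by
    rw [← Real.exp_add, Real.exp_le_exp]
    nlinarith
  have h3 : S * 2 * Real.exp (b - 1) ≤ Real.exp (-a) * Real.exp (b - 1) := by
    refine le_trans ?_ (h1.trans h2)
    rw [mul_assoc]
    gcongr
  have := le_of_mul_le_mul_right h3 (Real.exp_pos _)
  linarith

theorem reward_mean_mem_Icc (x : 𝒳) (v : 𝒱) : ∫ y, y ∂(E.q x v) ∈ Set.Icc (0 : ℝ) 1 := by
  have := E.q_prob x v
  have h : ∀ᵐ y ∂(E.q x v), y ∈ Set.Icc (0 : ℝ) 1 := E.q_supp x v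
  constructor
  · exact integral_nonneg_of_ae (h.mono fun y hy => hy.1)
  · have := integral_mono_of_nonneg (μ := E.q x v) (f := fun y => y) (g := fun _ => (1 : ℝ))
      (h.mono fun y hy => hy.1) (integrable_const _) (h.mono fun y hy => hy.2)
    simpa using this

theorem mean_le_one (i : Fin N) : E.mean i ≤ 1 := by
  calc E.mean i ≤ ∑ x, E.p x * ∑ v, E.policy i x v * 1 := by
        refine Finset.sum_le_sum fun x _ => mul_le_mul_of_nonneg_left
          (Finset.sum_le_sum fun v _ => mul_le_mul_of_nonneg_left
            (E.reward_mean_mem_Icc x v).2 (E.policy_pos i x v).le) (E.p_nonneg x)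
    _ = 1 := by simp [E.policy_sum, E.p_sum]

theorem mean_le_bestMean (i : Fin N) : E.mean i ≤ E.bestMean :=
  le_ciSup (f := E.mean) (Set.finite_range _).bddAbove i

theorem exists_mean_eq_bestMean [Nonempty (Fin N)] :
    ∃ i, E.mean i = E.bestMean :=
  exists_eq_ciSup_of_finite

theorem gap_nonneg (i : Fin N) : 0 ≤ E.gap i := sub_nonneg.2 (E.mean_le_bestMean i)

theorem sum_weight (j : Fin N) : ∑ x, ∑ v, E.p x * E.policy j x v = 1 := by
  simp only [← Finset.mul_sum, E.policy_sum, mul_one, E.p_sum]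

theorem weight_nonneg (j : Fin N) (x : 𝒳) (v : 𝒱) : 0 ≤ E.p x * E.policy j x v :=
  mul_nonneg (E.p_nonneg x) (E.policy_pos j x v).le

theorem normalizer_le (i : Fin N) (t : ℕ) (h : ℕ → Round N 𝒳 𝒱) : E.normalizer i t h ≤ t := by
  have : ∀ s ∈ Finset.range t, 1 / E.logDiv i (h s).1 ≤ 1 := fun s _ =>
    (div_le_one (E.logDiv_pos _ _)).2 (E.one_le_logDiv _ _)
  simpa [normalizer] using Finset.sum_le_sum this

theorem div_le_normalizer {M : ℝ} (hM : ∀ i j, E.logDiv i j ≤ M) (i : Fin N) (t : ℕ)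
    (h : ℕ → Round N 𝒳 𝒱) : t / M ≤ E.normalizer i t h := by
  have : ∀ s ∈ Finset.range t, 1 / M ≤ 1 / E.logDiv i (h s).1 := fun s _ =>
    one_div_le_one_div_of_le (E.logDiv_pos _ _) (hM _ _)
  have := Finset.sum_le_sum this
  rwa [Finset.sum_const, Finset.card_range, nsmul_eq_mul, mul_one_div] at this

theorem normalizer_pos (i : Fin N) {t : ℕ} (ht : 0 < t) (h : ℕ → Round N 𝒳 𝒱) :
    0 < E.normalizer i t h :=
  Finset.sum_pos (fun _ _ => one_div_pos.2 (E.logDiv_pos _ _)) ⟨0, Finset.mem_range.2 ht⟩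

/-- The weighted reward of one round, clipped at importance ratio `2 a M_ij`. -/
noncomputable def clippedGain (i : Fin N) (a : ℝ) (r : Round N 𝒳 𝒱) : ℝ :=
  if E.ratio i r.1 r.2.1 r.2.2.1 ≤ 2 * a * E.logDiv i r.1
  then r.2.2.2 / E.logDiv i r.1 * E.ratio i r.1 r.2.1 r.2.2.1 else 0

/-- The mean of `clippedGain` in a round where expert `j` is played. -/
noncomputable def clippedMean (i : Fin N) (a : ℝ) (j : Fin N) : ℝ :=
  (1 / E.logDiv i j) * ∑ x, E.p x * ∑ v, E.policy i x v *
    if E.ratio i j x v ≤ 2 * a * E.logDiv i j then ∫ y, y ∂(E.q x v) else 0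

theorem clippedGain_mem_Icc (i : Fin N) {a : ℝ} (ha : 0 ≤ a) (r : Round N 𝒳 𝒱)
    (hr : r.2.2.2 ∈ Set.Icc (0 : ℝ) 1) : E.clippedGain i a r ∈ Set.Icc (0 : ℝ) (2 * a) := by
  have hL := E.logDiv_pos i r.1
  have hρ := E.ratio_pos i r.1 r.2.1 r.2.2.1
  have h0 := hr.1
  have h1 := hr.2
  unfold clippedGain
  split_ifs with h
  · refine ⟨by positivity, ?_⟩
    rw [div_mul_eq_mul_div, div_le_iff₀ hL]
    refine le_trans ?_ h
    exact mul_le_of_le_one_left hρ.le h1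
  · exact ⟨le_rfl, by positivity⟩

theorem clippedGain_mono (i : Fin N) {a b : ℝ} (hab : a ≤ b) (r : Round N 𝒳 𝒱)
    (hr : 0 ≤ r.2.2.2) : E.clippedGain i a r ≤ E.clippedGain i b r := by
  have hL := E.logDiv_pos i r.1
  have hρ := E.ratio_pos i r.1 r.2.1 r.2.2.1
  have : 2 * a * E.logDiv i r.1 ≤ 2 * b * E.logDiv i r.1 := by gcongr
  unfold clippedGain
  split_ifs with h h' h'
  · exact le_rfl
  · exact absurd (h.trans this) h'
  · positivity
  · exact le_rfl

theorem clippedMean_le (i : Fin N) (a : ℝ) (j : Fin N) :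
    E.clippedMean i a j ≤ E.mean i * (1 / E.logDiv i j) := by
  unfold clippedMean mean
  rw [mul_comm]
  refine mul_le_mul_of_nonneg_right ?_ (one_div_pos.2 (E.logDiv_pos i j)).le
  refine Finset.sum_le_sum fun x _ => mul_le_mul_of_nonneg_left
    (Finset.sum_le_sum fun v _ => mul_le_mul_of_nonneg_left
      ?_ (E.policy_pos i x v).le) (E.p_nonneg x)
  split_ifs
  · exact le_rfl
  · exact (E.reward_mean_mem_Icc x v).1

/-- Rewards are at most `1`, so clipping loses no more than the tail probability of the ratio. -/
theorem le_clippedMean (i : Fin N) {a : ℝ} (ha : 1 ≤ a) (j : Fin N) :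
    (E.mean i - Real.exp (-a) / 2) * (1 / E.logDiv i j) ≤ E.clippedMean i a j := by
  unfold clippedMean
  rw [mul_comm]
  refine mul_le_mul_of_nonneg_left ?_ (one_div_pos.2 (E.logDiv_pos i j)).le
  have h := E.ratio_tail_le i j ha
  refine (sub_le_sub_left h _).trans ?_
  rw [mean, ← Finset.sum_sub_distrib]
  refine Finset.sum_le_sum fun x _ => ?_
  rw [← mul_sub, ← Finset.sum_sub_distrib]
  refine mul_le_mul_of_nonneg_left (Finset.sum_le_sum fun v _ => ?_) (E.p_nonneg x)
  rw [← mul_sub]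
  refine mul_le_mul_of_nonneg_left ?_ (E.policy_pos i x v).le
  have := (E.reward_mean_mem_Icc x v).2
  split_ifs <;> linarith

end ExpertBandit

/-! ### The law of one round and Hoeffding's lemma for it -/

theorem lintegral_eq_sum_fiber {Ω ι : Type*} [MeasurableSpace Ω] {P : Measure Ω} [Fintype ι]
    [MeasurableSpace ι] [MeasurableSingletonClass ι] {k : Ω → ι} (hk : Measurable k)
    (f : Ω → ENNReal) : ∫⁻ ω, f ω ∂P = ∑ c, ∫⁻ ω in k ⁻¹' {c}, f ω ∂P := by
  rw [← setLIntegral_univ, ← tsum_fintype (L := .unconditional ι), ← lintegral_iUnion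
    (fun c => hk (measurableSet_singleton c))
    (fun a b hab => (Set.disjoint_singleton.2 hab).preimage k)]
  congr 2
  ext ω
  simp

theorem measurable_mk_mk {𝒳 𝒱 : Type*} [MeasurableSpace 𝒳] [MeasurableSpace 𝒱] (x : 𝒳)
    (v : 𝒱) : Measurable fun y : ℝ => (x, v, y) :=
  measurable_const.prodMk (measurable_const.prodMk measurable_id)

namespace ExpertBandit

open scoped ENNReal

variable {N : ℕ} {𝒳 𝒱 : Type*} [Fintype 𝒳] [Fintype 𝒱] [MeasurableSpace 𝒳] [MeasurableSpace 𝒱]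
  (E : ExpertBandit N 𝒳 𝒱)

/-- The joint law of context, action and reward in a round where expert `j` is played. -/
noncomputable def roundLaw (j : Fin N) : Measure (𝒳 × 𝒱 × ℝ) :=
  ∑ x, ∑ v, ENNReal.ofReal (E.p x * E.policy j x v) • (E.q x v).map fun y => (x, v, y)

theorem lintegral_roundLaw (j : Fin N) {g : 𝒳 × 𝒱 × ℝ → ℝ≥0∞} (hg : Measurable g) :
    ∫⁻ z, g z ∂(E.roundLaw j) = ∑ x, ∑ v,
      ENNReal.ofReal (E.p x * E.policy j x v) * ∫⁻ y, g (x, v, y) ∂(E.q x v) := by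
  simp only [roundLaw, lintegral_finsetSum_measure, lintegral_smul_measure, smul_eq_mul,
    lintegral_map hg (measurable_mk_mk _ _)]

instance isProbabilityMeasure_roundLaw (j : Fin N) : IsProbabilityMeasure (E.roundLaw j) := by
  refine ⟨?_⟩
  have := E.q_prob
  have h := E.lintegral_roundLaw j (measurable_const (a := (1 : ℝ≥0∞)))
  simp only [lintegral_const, one_mul, measure_univ, mul_one] at h
  rw [h]
  simp_rw [← ENNReal.ofReal_sum_of_nonneg fun v _ => E.weight_nonneg j _ v]
  rw [← ENNReal.ofReal_sum_of_nonneg fun x _ => Finset.sum_nonneg fun v _ =>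
    E.weight_nonneg j x v, E.sum_weight, ENNReal.ofReal_one]

theorem ae_roundLaw (j : Fin N) {s : Set (𝒳 × 𝒱 × ℝ)} (hs : MeasurableSet s)
    (h : ∀ x v, ∀ᵐ y ∂(E.q x v), (x, v, y) ∈ s) : ∀ᵐ z ∂(E.roundLaw j), z ∈ s := by
  change E.roundLaw j sᶜ = 0
  have h0 : ∀ x v, ENNReal.ofReal (E.p x * E.policy j x v) *
      (E.q x v) ((fun y => (x, v, y)) ⁻¹' sᶜ) = 0 := fun x v => by
    rw [show E.q x v ((fun y => (x, v, y)) ⁻¹' sᶜ) = 0 from h x v, mul_zero]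
  simp only [roundLaw, Measure.finsetSum_apply, Measure.smul_apply, smul_eq_mul,
    Measure.map_apply (measurable_mk_mk _ _) hs.compl, h0, Finset.sum_const_zero]

theorem integral_roundLaw (j : Fin N) {g : 𝒳 × 𝒱 × ℝ → ℝ} (hg : Measurable g)
    (hi : Integrable g (E.roundLaw j)) :
    ∫ z, g z ∂(E.roundLaw j) = ∑ x, E.p x * ∑ v, E.policy j x v *
      ∫ y, g (x, v, y) ∂(E.q x v) := by
  have hle : ∀ x v, ENNReal.ofReal (E.p x * E.policy j x v) •
      (E.q x v).map (fun y => (x, v, y)) ≤ E.roundLaw j := by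
    intro x v
    refine le_trans ?_ (Finset.single_le_sum (f := fun x => ∑ v,
      ENNReal.ofReal (E.p x * E.policy j x v) • (E.q x v).map fun y => (x, v, y))
      (fun _ _ => Measure.zero_le _) (Finset.mem_univ x))
    exact Finset.single_le_sum (f := fun v =>
      ENNReal.ofReal (E.p x * E.policy j x v) • (E.q x v).map fun y => (x, v, y))
      (fun _ _ => Measure.zero_le _) (Finset.mem_univ v)
  have hi' := fun x v => hi.mono_measure (hle x v)
  rw [roundLaw, integral_finsetSum_measure fun x _ => integrable_finsetSum_measure.2
    fun v _ => hi' x v]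
  refine Finset.sum_congr rfl fun x _ => ?_
  rw [integral_finsetSum_measure fun v _ => hi' x v, Finset.mul_sum]
  refine Finset.sum_congr rfl fun v _ => ?_
  rw [integral_smul_measure, integral_map (measurable_mk_mk x v).aemeasurable
    hg.aestronglyMeasurable, ENNReal.toReal_ofReal (E.weight_nonneg j x v), smul_eq_mul, mul_assoc]

section Run

variable [DiscreteMeasurableSpace 𝒳] [DiscreteMeasurableSpace 𝒱]

theorem measurable_clippedGain (i : Fin N) (a : ℝ) : Measurable (E.clippedGain i a) := by
  let f : Fin N × 𝒳 × 𝒱 → ℝ := fun c => if E.ratio i c.1 c.2.1 c.2.2 ≤ 2 * a * E.logDiv i c.1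
    then E.ratio i c.1 c.2.1 c.2.2 / E.logDiv i c.1 else 0
  have hf : Measurable f := Measurable.of_discrete
  have hp : Measurable fun r : Round N 𝒳 𝒱 => (r.1, r.2.1, r.2.2.1) := by fun_prop
  have : E.clippedGain i a = fun r => f (r.1, r.2.1, r.2.2.1) * r.2.2.2 := by
    funext r
    simp only [clippedGain, f]
    split_ifs
    · ring
    · ring
  rw [this]
  exact (hf.comp hp).mul (by fun_prop)

theorem ae_clippedGain_mem_Icc (i : Fin N) {a : ℝ} (ha : 0 ≤ a) (j : Fin N) :
    ∀ᵐ z ∂(E.roundLaw j), E.clippedGain i a (j, z) ∈ Set.Icc (0 : ℝ) (2 * a) := by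
  refine E.ae_roundLaw j (s := {z | E.clippedGain i a (j, z) ∈ Set.Icc (0 : ℝ) (2 * a)})
    (((E.measurable_clippedGain i a).comp measurable_prodMk_left) measurableSet_Icc) fun x v => ?_
  have h : ∀ᵐ y ∂(E.q x v), y ∈ Set.Icc (0 : ℝ) 1 := E.q_supp x v
  exact h.mono fun y hy => E.clippedGain_mem_Icc i ha (j, x, v, y) hy

/-- Change of measure: `π_j r_ij = π_i`, so gains collected under `j` average as under `i`. -/
theorem integral_clippedGain (i : Fin N) {a : ℝ} (ha : 0 ≤ a) (j : Fin N) :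
    ∫ z, E.clippedGain i a (j, z) ∂(E.roundLaw j) = E.clippedMean i a j := by
  have hm : Measurable fun z => E.clippedGain i a (j, z) :=
    (E.measurable_clippedGain i a).comp measurable_prodMk_left
  rw [E.integral_roundLaw j hm
    (Integrable.of_mem_Icc 0 (2 * a) hm.aemeasurable (E.ae_clippedGain_mem_Icc i ha j)),
    clippedMean, Finset.mul_sum]
  refine Finset.sum_congr rfl fun x _ => ?_
  rw [mul_left_comm]
  refine congrArg (E.p x * ·) ?_
  rw [Finset.mul_sum]
  refine Finset.sum_congr rfl fun v _ => ?_
  unfold clippedGain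
  have hL := E.logDiv_pos i j
  have hj := E.policy_pos j x v
  by_cases h : E.ratio i j x v ≤ 2 * a * E.logDiv i j
  · simp only [h, if_true]
    rw [integral_mul_const, integral_div]
    unfold ratio
    field_simp
  · simp [h]

/-- Hoeffding's lemma on an interval of length `2a`, hence variance proxy `a²`. The bound does not
depend on the expert `j` played, which lets it leave the integral in the induction over rounds. -/
theorem lintegral_exp_clippedGain_le (i : Fin N) {a : ℝ} (ha : 0 ≤ a) (θ : ℝ) (j : Fin N) :
    ∫⁻ z, ENNReal.ofReal (Real.exp (θ * (E.clippedGain i a (j, z) - E.clippedMean i a j)))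
      ∂(E.roundLaw j) ≤ ENNReal.ofReal (Real.exp (a ^ 2 * θ ^ 2 / 2)) := by
  have hm : Measurable fun z => E.clippedGain i a (j, z) :=
    (E.measurable_clippedGain i a).comp measurable_prodMk_left
  have h := ProbabilityTheory.hasSubgaussianMGF_of_mem_Icc hm.aemeasurable
    (E.ae_clippedGain_mem_Icc i ha j)
  rw [E.integral_clippedGain i ha j] at h
  rw [← ofReal_integral_eq_lintegral_ofReal (h.integrable_exp_mul θ)
    (ae_of_all _ fun _ => (Real.exp_pos _).le)]
  refine ENNReal.ofReal_le_ofReal ((h.mgf_le θ).trans_eq ?_)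
  congr 3
  simp only [sub_zero, NNReal.coe_pow, NNReal.coe_div, coe_nnnorm, Real.norm_eq_abs,
    NNReal.coe_ofNat]
  rw [div_pow, sq_abs]
  ring

/-! ### Conditioning on the past and concentration along a run -/

variable {E} {C : ℝ} {Ω : Type*} [MeasurableSpace Ω] {P : Measure Ω} [IsProbabilityMeasure P]
  {H : ℕ → Ω → Round N 𝒳 𝒱}

theorem IsDUCBRun.measurable_past (hH : E.IsDUCBRun C P H) (t : ℕ) :
    Measurable fun ω => fun s : Fin t => H s ω :=
  measurable_pi_lambda _ fun s => hH.measurable s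

/-- The field `law` treats rectangles only. Uniqueness of product measures upgrades it: on the fibre
`(i, x, v)`, past and reward have a product law, whose first factor is the past restricted to the
event that `i` is played. The choice of `i` may therefore use extra randomness. -/
theorem IsDUCBRun.setLIntegral_eq (hH : E.IsDUCBRun C P H) (t : ℕ)
    {F : (Fin t → Round N 𝒳 𝒱) → ℝ≥0∞} (hF : Measurable F)
    {g : Round N 𝒳 𝒱 → ℝ≥0∞} (hg : Measurable g) (i : Fin N) (x : 𝒳) (v : 𝒱) :
    ∫⁻ ω in {ω | (H t ω).1 = i ∧ (H t ω).2.1 = x ∧ (H t ω).2.2.1 = v},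
        F (fun s => H s ω) * g (H t ω) ∂P
      = (∫⁻ ω in {ω | (H t ω).1 = i}, F (fun s => H s ω) ∂P) *
        (ENNReal.ofReal (E.p x * E.policy i x v) * ∫⁻ y, g (i, x, v, y) ∂(E.q x v)) := by
  have := E.q_prob x v
  have hX := hH.measurable_past t
  have h1 : Measurable fun ω => (H t ω).1 := (hH.measurable t).fst
  have h2 : Measurable fun ω => (H t ω).2.1 := (hH.measurable t).snd.fst
  have h3 : Measurable fun ω => (H t ω).2.2.1 := (hH.measurable t).snd.snd.fst
  have hY : Measurable fun ω => (H t ω).2.2.2 := (hH.measurable t).snd.snd.snd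
  set S : Set Ω := {ω | (H t ω).1 = i} with hS
  set S' : Set Ω := {ω | (H t ω).1 = i ∧ (H t ω).2.1 = x ∧ (H t ω).2.2.1 = v} with hS'
  have mS : MeasurableSet S := h1 (measurableSet_singleton i)
  have mS' : MeasurableSet S' :=
    mS.inter ((h2 (measurableSet_singleton x)).inter (h3 (measurableSet_singleton v)))
  have : IsFiniteMeasure (ENNReal.ofReal (E.p x * E.policy i x v) • E.q x v) :=
    (E.q x v).smul_finite ENNReal.ofReal_ne_top
  have key : ((P.restrict S).map fun ω => fun s : Fin t => H s ω).prod
      (ENNReal.ofReal (E.p x * E.policy i x v) • E.q x v) =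
      (P.restrict S').map fun ω => ((fun s : Fin t => H s ω), (H t ω).2.2.2) := by
    refine Measure.prod_eq fun A B hA hB => ?_
    rw [Measure.map_apply (hX.prodMk hY) (hA.prod hB), Measure.map_apply hX hA,
      Measure.restrict_apply ((hX.prodMk hY) (hA.prod hB)), Measure.restrict_apply (hX hA),
      Measure.smul_apply, smul_eq_mul]
    refine Eq.trans (congrArg P ?_) (hH.law t A i x v B hA hB)
    ext ω
    simp only [hS', Set.mem_inter_iff, Set.mem_preimage, Set.mem_prod, Set.mem_ofPred_eq]
    tauto
  have hg' : Measurable fun y => g (i, x, v, y) :=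
    (hg.comp measurable_prodMk_left).comp (measurable_mk_mk x v)
  have e1 : ∫⁻ ω in S', F (fun s => H s ω) * g (H t ω) ∂P =
      ∫⁻ ω in S', F (fun s => H s ω) * g (i, x, v, (H t ω).2.2.2) ∂P := by
    refine setLIntegral_congr_fun mS' fun ω hω => ?_
    obtain ⟨a, b, c⟩ := hω
    have : H t ω = (i, x, v, (H t ω).2.2.2) := by rw [← a, ← b, ← c]
    change _ * g (H t ω) = _
    rw [this]
  rw [e1, ← lintegral_map (μ := P.restrict S') (f := fun z : (Fin t → Round N 𝒳 𝒱) × ℝ =>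
      F z.1 * g (i, x, v, z.2)) (by fun_prop) (hX.prodMk hY), ← key,
    lintegral_prod_mul hF.aemeasurable hg'.aemeasurable, lintegral_map hF hX,
    lintegral_smul_measure, smul_eq_mul]

/-- Integrating a round out, conditionally on the past and on the expert played. -/
theorem IsDUCBRun.lintegral_eq (hH : E.IsDUCBRun C P H) (t : ℕ)
    {F : (Fin t → Round N 𝒳 𝒱) → ℝ≥0∞} (hF : Measurable F)
    {g : Round N 𝒳 𝒱 → ℝ≥0∞} (hg : Measurable g) :
    ∫⁻ ω, F (fun s => H s ω) * g (H t ω) ∂P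
      = ∫⁻ ω, F (fun s => H s ω) * ∫⁻ z, g ((H t ω).1, z) ∂(E.roundLaw (H t ω).1) ∂P := by
  have hX := hH.measurable_past t
  have h1 : Measurable fun ω => (H t ω).1 := (hH.measurable t).fst
  have hc : Measurable fun ω => ((H t ω).1, (H t ω).2.1, (H t ω).2.2.1) := by
    have := hH.measurable t
    fun_prop
  have hF' : Measurable fun ω => F fun s : Fin t => H s ω := hF.comp hX
  rw [lintegral_eq_sum_fiber hc, lintegral_eq_sum_fiber h1, Fintype.sum_prod_type]
  refine Finset.sum_congr rfl fun i _ => ?_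
  have e : ∫⁻ ω in (fun ω => (H t ω).1) ⁻¹' {i},
      F (fun s => H s ω) * ∫⁻ z, g ((H t ω).1, z) ∂(E.roundLaw (H t ω).1) ∂P =
      ∫⁻ ω in (fun ω => (H t ω).1) ⁻¹' {i},
        F (fun s => H s ω) * ∫⁻ z, g (i, z) ∂(E.roundLaw i) ∂P := by
    refine setLIntegral_congr_fun (h1 (measurableSet_singleton i)) fun ω hω => ?_
    have : (H t ω).1 = i := hω
    change _ * ∫⁻ z, g ((H t ω).1, z) ∂(E.roundLaw (H t ω).1) = _
    rw [this]
  rw [e, lintegral_mul_const _ hF', E.lintegral_roundLaw i (g := fun z => g (i, z))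
      (hg.comp measurable_prodMk_left),
    Fintype.sum_prod_type, Finset.mul_sum]
  refine Finset.sum_congr rfl fun x _ => ?_
  rw [Finset.mul_sum]
  refine Finset.sum_congr rfl fun v _ => ?_
  refine Eq.trans ?_ (hH.setLIntegral_eq t hF hg i x v)
  congr 2
  ext ω
  simp [Prod.ext_iff]

theorem IsDUCBRun.ae_reward_mem_Icc (hH : E.IsDUCBRun C P H) :
    ∀ᵐ ω ∂P, ∀ t, (H t ω).2.2.2 ∈ Set.Icc (0 : ℝ) 1 := by
  refine ae_all_iff.2 fun t => ?_
  let g : Round N 𝒳 𝒱 → ℝ≥0∞ := fun r => (Set.Icc (0 : ℝ) 1)ᶜ.indicator 1 r.2.2.2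
  have hg : Measurable g :=
    (measurable_one.indicator measurableSet_Icc.compl).comp (by fun_prop)
  have h := hH.lintegral_eq t (F := fun _ => 1) measurable_const hg
  have h0 : ∀ j, ∫⁻ z, g (j, z) ∂(E.roundLaw j) = 0 := by
    intro j
    rw [E.lintegral_roundLaw j (g := fun z => g (j, z)) (hg.comp measurable_prodMk_left)]
    simp [g, lintegral_indicator_one measurableSet_Icc.compl, E.q_supp]
  simp only [h0, one_mul, lintegral_zero] at h
  rw [lintegral_eq_zero_iff (f := fun ω => g (H t ω)) (hg.comp (hH.measurable t))] at h
  filter_upwards [h] with ω hω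
  by_contra hn
  have : g (H t ω) = 1 := Set.indicator_of_mem (s := (Set.Icc (0 : ℝ) 1)ᶜ) hn _
  simp [this] at hω

/-- The sum of the centred clipped gains over the first `t` rounds. -/
noncomputable def deviation (E : ExpertBandit N 𝒳 𝒱) (i : Fin N) (a : ℝ) (t : ℕ)
    (h : ℕ → Round N 𝒳 𝒱) : ℝ :=
  ∑ s ∈ Finset.range t, (E.clippedGain i a (h s) - E.clippedMean i a (h s).1)

theorem measurable_centred (i : Fin N) (a : ℝ) :
    Measurable fun r : Round N 𝒳 𝒱 => E.clippedGain i a r - E.clippedMean i a r.1 :=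
  (E.measurable_clippedGain i a).sub
    ((Measurable.of_discrete (f := E.clippedMean i a)).comp measurable_fst)

theorem IsDUCBRun.measurable_deviation (hH : E.IsDUCBRun C P H) (i : Fin N) (a : ℝ) (t : ℕ) :
    Measurable fun ω => E.deviation i a t fun s => H s ω :=
  Finset.measurable_fun_sum _ fun s _ => (measurable_centred i a).comp (hH.measurable s)

/-- Azuma–Hoeffding by induction: the last round is integrated out given the past and the expert
played, contributing one factor `exp (a² θ² / 2)`. -/
theorem IsDUCBRun.lintegral_exp_deviation_le (hH : E.IsDUCBRun C P H) (i : Fin N) {a : ℝ}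
    (ha : 0 ≤ a) (θ : ℝ) (t : ℕ) :
    ∫⁻ ω, ENNReal.ofReal (Real.exp (θ * E.deviation i a t fun s => H s ω)) ∂P
      ≤ ENNReal.ofReal (Real.exp (t * (a ^ 2 * θ ^ 2 / 2))) := by
  induction t with
  | zero => simp [deviation]
  | succ t ih =>
    have hm := measurable_centred (E := E) i a
    have hF : Measurable fun h : Fin t → Round N 𝒳 𝒱 => ENNReal.ofReal (Real.exp
        (θ * ∑ s, (E.clippedGain i a (h s) - E.clippedMean i a (h s).1))) := by
      have : Measurable fun h : Fin t → Round N 𝒳 𝒱 =>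
          ∑ s, (E.clippedGain i a (h s) - E.clippedMean i a (h s).1) :=
        Finset.measurable_fun_sum _ fun s _ => hm.comp (measurable_pi_apply s)
      fun_prop
    have hg : Measurable fun r : Round N 𝒳 𝒱 => ENNReal.ofReal (Real.exp
        (θ * (E.clippedGain i a r - E.clippedMean i a r.1))) := by fun_prop
    have h := hH.lintegral_eq t hF hg
    have e : ∀ ω, ENNReal.ofReal (Real.exp (θ * E.deviation i a (t + 1) fun s => H s ω)) =
        ENNReal.ofReal (Real.exp (θ * ∑ s : Fin t,
          (E.clippedGain i a (H s ω) - E.clippedMean i a (H s ω).1))) *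
        ENNReal.ofReal (Real.exp
          (θ * (E.clippedGain i a (H t ω) - E.clippedMean i a (H t ω).1))) := by
      intro ω
      rw [← ENNReal.ofReal_mul (Real.exp_pos _).le, ← Real.exp_add, deviation,
        Finset.sum_range_succ, mul_add, Finset.sum_range]
    simp_rw [e]
    rw [h]
    calc _ ≤ ∫⁻ ω, ENNReal.ofReal (Real.exp (θ * ∑ s : Fin t,
          (E.clippedGain i a (H s ω) - E.clippedMean i a (H s ω).1))) *
          ENNReal.ofReal (Real.exp (a ^ 2 * θ ^ 2 / 2)) ∂P :=
        lintegral_mono fun ω => by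
          gcongr
          exact E.lintegral_exp_clippedGain_le i ha θ (H t ω).1
      _ = (∫⁻ ω, ENNReal.ofReal (Real.exp (θ * E.deviation i a t fun s => H s ω)) ∂P) *
          ENNReal.ofReal (Real.exp (a ^ 2 * θ ^ 2 / 2)) := by
        simp only [deviation, Finset.sum_range]
        exact lintegral_mul_const _ (hF.comp (hH.measurable_past t))
      _ ≤ ENNReal.ofReal (Real.exp (t * (a ^ 2 * θ ^ 2 / 2))) *
          ENNReal.ofReal (Real.exp (a ^ 2 * θ ^ 2 / 2)) := by gcongr
      _ = _ := by
        rw [← ENNReal.ofReal_mul (Real.exp_pos _).le, ← Real.exp_add]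
        push_cast
        ring_nf

theorem IsDUCBRun.measure_deviation_ge_le (hH : E.IsDUCBRun C P H) (i : Fin N) {a : ℝ}
    (ha : 0 ≤ a) (θ b : ℝ) (t : ℕ) :
    P {ω | b ≤ θ * E.deviation i a t fun s => H s ω} ≤
      ENNReal.ofReal (Real.exp (t * (a ^ 2 * θ ^ 2 / 2) - b)) := by
  have hm := hH.measurable_deviation i a t
  have h := meas_ge_le_lintegral_div (μ := P)
    (f := fun ω => ENNReal.ofReal (Real.exp (θ * E.deviation i a t fun s => H s ω)))
    (ENNReal.measurable_ofReal.comp (Real.measurable_exp.comp (hm.const_mul θ))).aemeasurable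
    (ε := ENNReal.ofReal (Real.exp b))
    (by simp [Real.exp_pos]) ENNReal.ofReal_ne_top
  have hs : {ω | b ≤ θ * E.deviation i a t fun s => H s ω} = {ω | ENNReal.ofReal (Real.exp b) ≤
      ENNReal.ofReal (Real.exp (θ * E.deviation i a t fun s => H s ω))} := by
    ext ω
    simp only [Set.mem_ofPred_eq, ENNReal.ofReal_le_ofReal_iff (Real.exp_pos _).le,
      Real.exp_le_exp]
  rw [hs]
  refine h.trans ?_
  rw [Real.exp_sub, ENNReal.ofReal_div_of_pos (Real.exp_pos _)]
  gcongr
  exact hH.lintegral_exp_deviation_le i ha θ t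

/-- At some integer clipping level, the deviation of the first `t` rounds is large. -/
def deviationEvent (E : ExpertBandit N 𝒳 𝒱) (i : Fin N) (t : ℕ) : Set (ℕ → Round N 𝒳 𝒱) :=
  {h | ∃ n ∈ Finset.Icc 1 t, 4 * n * √(t * Real.log t) ≤ |E.deviation i n t h|}

theorem IsDUCBRun.measurableSet_deviationEvent (hH : E.IsDUCBRun C P H) (i : Fin N) (t : ℕ) :
    MeasurableSet {ω | (fun s => H s ω) ∈ E.deviationEvent i t} := by
  have : {ω | (fun s => H s ω) ∈ E.deviationEvent i t} = ⋃ n ∈ Finset.Icc 1 t,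
      {ω | 4 * n * √(t * Real.log t) ≤ |E.deviation i n t fun s => H s ω|} := by
    ext ω
    simp [deviationEvent]
  rw [this]
  refine Finset.measurableSet_biUnion _ fun n _ => ?_
  have := hH.measurable_deviation i n t
  exact measurableSet_le measurable_const (by fun_prop)

theorem IsDUCBRun.measure_deviationEvent_le (hH : E.IsDUCBRun C P H) (i : Fin N) {t : ℕ}
    (ht : 2 ≤ t) :
    P {ω | (fun s => H s ω) ∈ E.deviationEvent i t} ≤ ENNReal.ofReal (1 / (t : ℝ) ^ 2) := by
  have ht' : (2 : ℝ) ≤ t := by exact_mod_cast ht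
  have hlog : 0 < Real.log t := Real.log_pos (by linarith)
  have hone : ∀ n ∈ Finset.Icc 1 t,
      P {ω | 4 * n * √(t * Real.log t) ≤ |E.deviation i n t fun s => H s ω|} ≤
        ENNReal.ofReal (2 / (t : ℝ) ^ 8) := by
    intro n hn
    have hn0 : (0 : ℝ) < n := by exact_mod_cast (Finset.mem_Icc.1 hn).1
    set R := √(t * Real.log t) with hR
    have hRR : R * R = t * Real.log t := Real.mul_self_sqrt (by positivity)
    have hR0 : 0 ≤ R := Real.sqrt_nonneg _
    -- The minimiser of the Chernoff exponent `t n² θ² / 2 - 4 n R θ`; the minimum is `-8 log t`.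
    set θ : ℝ := 4 * R / (t * n) with hθ
    have hθ0 : 0 ≤ θ := by positivity
    have hθR : θ * (4 * n * R) = 16 * Real.log t := by
      have : θ * (4 * n * R) = 16 * (R * R) / t := by rw [hθ]; field_simp; ring
      rw [this, hRR]
      field_simp
    have hv : (t : ℝ) * ((n : ℝ) ^ 2 * θ ^ 2 / 2) - 16 * Real.log t = -(8 * Real.log t) := by
      have : (t : ℝ) * ((n : ℝ) ^ 2 * θ ^ 2 / 2) = 8 * (R * R) / t := by
        rw [hθ]; field_simp; ring
      rw [this, hRR]
      field_simp
      ring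
    have hexp : Real.exp (-(8 * Real.log t)) = 1 / (t : ℝ) ^ 8 := by
      rw [Real.exp_neg, show 8 * Real.log t = ((8 : ℕ) : ℝ) * Real.log t by norm_num,
        Real.exp_nat_mul, Real.exp_log (by linarith), one_div]
    have h1 := hH.measure_deviation_ge_le i hn0.le θ (16 * Real.log t) t
    have h2 := hH.measure_deviation_ge_le i hn0.le (-θ) (16 * Real.log t) t
    rw [neg_sq] at h2
    rw [hv, hexp] at h1 h2
    calc _ ≤ P ({ω | 16 * Real.log t ≤ θ * E.deviation i n t fun s => H s ω} ∪
          {ω | 16 * Real.log t ≤ -θ * E.deviation i n t fun s => H s ω}) := by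
          refine measure_mono fun ω hω => ?_
          have hω : 4 * n * R ≤ |E.deviation i n t fun s => H s ω| := hω
          rcases le_abs.1 hω with h | h
          · left
            change 16 * Real.log t ≤ θ * E.deviation i n t fun s => H s ω
            rw [← hθR]
            gcongr
          · right
            change 16 * Real.log t ≤ -θ * E.deviation i n t fun s => H s ω
            rw [← hθR, neg_mul, ← mul_neg]
            gcongr
      _ ≤ _ := measure_union_le _ _
      _ ≤ _ := add_le_add h1 h2
      _ = _ := by
        rw [← ENNReal.ofReal_add (by positivity) (by positivity)]
        ring_nf
  have : {ω | (fun s => H s ω) ∈ E.deviationEvent i t} = ⋃ n ∈ Finset.Icc 1 t,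
      {ω | 4 * n * √(t * Real.log t) ≤ |E.deviation i n t fun s => H s ω|} := by
    ext ω
    simp [deviationEvent]
  rw [this]
  -- Over the `t` levels the total is `2 t⁻⁷`, below `t⁻²`.
  refine (measure_biUnion_finset_le _ _).trans ((Finset.sum_le_sum hone).trans ?_)
  rw [Finset.sum_const, Nat.card_Icc, Nat.add_sub_cancel, nsmul_eq_mul,
    ← ENNReal.ofReal_natCast, ← ENNReal.ofReal_mul (by positivity)]
  refine ENNReal.ofReal_le_ofReal ?_
  rw [mul_div_assoc', div_le_div_iff₀ (by positivity) (by positivity)]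
  have : (2 : ℝ) ≤ t ^ 5 := by
    calc (2 : ℝ) ≤ 2 ^ 5 := by norm_num
      _ ≤ t ^ 5 := by gcongr
  have : (t : ℝ) ^ 3 * 2 ≤ t ^ 3 * t ^ 5 := by gcongr
  nlinarith

end Run
end ExpertBandit

/-! ### Monotonicity of the clipping function and persistence of the burn-in condition -/

theorem clipW_le {x y : ℝ} (hx : 0 < x) (hy : y ∈ Set.Ioo (0 : ℝ) 2)
    (hxy : x ≤ y / Real.log (2 / y)) : clipW x ≤ y := by
  obtain ⟨hw, hwx⟩ := clipW_spec hx
  by_contra! hlt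
  have hlogw : 0 < Real.log (2 / clipW x) :=
    Real.log_pos (by rw [lt_div_iff₀ hw.1]; linarith [hw.2])
  have hlog : Real.log (2 / clipW x) < Real.log (2 / y) := by
    refine Real.log_lt_log (div_pos two_pos hw.1) ?_
    exact div_lt_div_of_pos_left two_pos hy.1 hlt
  have : y / Real.log (2 / y) < clipW x / Real.log (2 / clipW x) :=
    div_lt_div₀ hlt hlog.le hw.1.le hlogw
  linarith

theorem one_le_log_of_three_le {x : ℝ} (hx : 3 ≤ x) : 1 ≤ Real.log x := by
  rw [Real.le_log_iff_exp_le (by linarith)]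
  linarith [Real.exp_one_lt_d9]

/-- `tauSub` is only a first time; the inequality persists because `t / log t` increases beyond `e`.
-/
theorem tauSub_spec {C M Δ : ℝ} (hC : 32 ≤ C) (hM : 1 ≤ M) (hΔ : 0 < Δ) (hΔ1 : Δ ≤ 1) {t : ℕ}
    (ht : tauSub C M Δ ≤ t) : 3 ≤ t ∧
      9 * C ^ 2 * M ^ 2 * Real.log (6 * C / Δ) ^ 2 / Δ ^ 2 ≤ (t : ℝ) / Real.log t := by
  set B := 9 * C ^ 2 * M ^ 2 * Real.log (6 * C / Δ) ^ 2 / Δ ^ 2 with hB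
  have hlog : 1 ≤ Real.log (6 * C / Δ) := one_le_log_of_three_le (by
    rw [le_div_iff₀ hΔ]; nlinarith)
  have hB9 : 9 ≤ B := by
    rw [hB, le_div_iff₀ (by positivity)]
    calc 9 * Δ ^ 2 ≤ 9 * 1 ^ 2 * 1 ^ 2 * 1 ^ 2 := by
          have : Δ ^ 2 ≤ 1 := pow_le_one₀ hΔ.le hΔ1
          linarith
      _ ≤ _ := by gcongr; linarith
  -- Without a witness the infimum would be the default value `0`.
  have hne : {t : ℕ | 2 ≤ t ∧ B ≤ (t : ℝ) / Real.log t}.Nonempty := by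
    have hlim := (Real.isLittleO_log_id_atTop.tendsto_div_nhds_zero.comp
      tendsto_natCast_atTop_atTop).eventually_le_const (show (0 : ℝ) < 1 / B by positivity)
    obtain ⟨n, hn, hn2⟩ := (hlim.and (Filter.eventually_ge_atTop 2)).exists
    refine ⟨n, hn2, ?_⟩
    have hn2' : (2 : ℝ) ≤ n := by exact_mod_cast hn2
    have hl : 0 < Real.log n := Real.log_pos (by linarith)
    have hn : Real.log n / n ≤ 1 / B := hn
    rw [div_le_div_iff₀ (by positivity) (by positivity)] at hn
    rw [le_div_iff₀ hl]
    linarith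
  obtain ⟨h2, hτ⟩ : 2 ≤ tauSub C M Δ ∧ B ≤ (tauSub C M Δ : ℝ) / Real.log (tauSub C M Δ) :=
    Nat.sInf_mem hne
  generalize tauSub C M Δ = τ at *
  -- The time `2 < e` lies outside the monotone range, but the threshold is at least `9 > 2 / log
  -- 2`.
  have h3 : 3 ≤ τ := by
    rcases Nat.lt_or_ge 2 τ with h | h
    · exact h
    · obtain rfl : τ = 2 := le_antisymm h h2
      have : (2 : ℝ) / Real.log 2 < 9 := by
        rw [div_lt_iff₀ (Real.log_pos one_lt_two)]
        linarith [Real.log_two_gt_d9]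
      norm_num at hτ
      linarith
  refine ⟨h3.trans ht, hτ.trans ?_⟩
  have h3' : (3 : ℝ) ≤ τ := by exact_mod_cast h3
  have ht' : (τ : ℝ) ≤ t := by exact_mod_cast ht
  have he := Real.exp_one_lt_d9
  have hanti := Real.log_div_self_antitoneOn (show Real.exp 1 ≤ (τ : ℝ) by linarith)
    (show Real.exp 1 ≤ (t : ℝ) by linarith) ht'
  have hlt : 0 < Real.log t := Real.log_pos (by linarith)
  have := one_div_le_one_div_of_le (div_pos hlt (by linarith)) hanti
  rwa [one_div_div, one_div_div] at this

namespace ExpertBandit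

variable {N : ℕ} {𝒳 𝒱 : Type*} [Fintype 𝒳] [Fintype 𝒱] {E : ExpertBandit N 𝒳 𝒱}

/-! ### Deterministic bounds on a fixed trajectory -/

section Trajectory

variable {C : ℝ} {i : Fin N} {t : ℕ} {h : ℕ → Round N 𝒳 𝒱}

theorem sqrt_div_normalizer_pos (i : Fin N) (ht : 2 ≤ t) (h : ℕ → Round N 𝒳 𝒱) :
    0 < √(t * Real.log t) / E.normalizer i t h := by
  have ht' : (2 : ℝ) ≤ t := by exact_mod_cast ht
  have hlog : 0 < Real.log t := Real.log_pos (by linarith)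
  exact div_pos (by positivity) (E.normalizer_pos i (by omega) h)

theorem eps_pos (hC : 32 ≤ C) (i : Fin N) (ht : 2 ≤ t) (h : ℕ → Round N 𝒳 𝒱) :
    0 < E.eps C i t h :=
  mul_pos (by linarith) (clipW_spec (sqrt_div_normalizer_pos i ht h)).1.1

theorem estimate_eq (hε : 0 < E.eps C i t h) :
    E.estimate C i t h = (1 / E.normalizer i t h) *
      ∑ s ∈ Finset.range t, E.clippedGain i (Real.log (2 / E.eps C i t h)) (h s) := by
  simp [estimate, clippedGain, hε.ne']

theorem estimate_nonneg (hε : 0 < E.eps C i t h)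
    (hy : ∀ s, (h s).2.2.2 ∈ Set.Icc (0 : ℝ) 1) : 0 ≤ E.estimate C i t h := by
  rw [estimate_eq hε]
  refine mul_nonneg (one_div_nonneg.2
    (Finset.sum_nonneg fun s _ => (one_div_pos.2 (E.logDiv_pos _ _)).le))
    (Finset.sum_nonneg fun s _ => ?_)
  have h0 := (hy s).1
  have hL := E.logDiv_pos i (h s).1
  have hρ := E.ratio_pos i (h s).1 (h s).2.1 (h s).2.2.1
  unfold clippedGain
  split_ifs
  · positivity
  · exact le_rfl

/-- The integer clipping levels next to `log (2 / ε)` are at most `t`, and the deviation allowed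
at such a level is at most `ε / 8`. -/
theorem level_le (hC : 32 ≤ C) (ht : 2 ≤ t) (hε : E.eps C i t h < 1) {n : ℕ}
    (hn : n < Real.log (2 / E.eps C i t h) + 1) :
    n ≤ t ∧ 4 * n * √(t * Real.log t) ≤ E.eps C i t h / 8 * E.normalizer i t h := by
  have ht' : (2 : ℝ) ≤ t := by exact_mod_cast ht
  have hlogt : 1 / 2 ≤ Real.log t := by
    have := Real.log_le_log two_pos ht'
    linarith [Real.log_two_gt_d9]
  have hZ := E.normalizer_pos i (show 0 < t by omega) h
  have hZt := E.normalizer_le i t h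
  obtain ⟨hw, hwx⟩ := clipW_spec (sqrt_div_normalizer_pos (E := E) i ht h)
  unfold eps at *
  set R := √(t * Real.log t) with hR
  set Z := E.normalizer i t h
  set w := clipW (R / Z)
  have hw0 := hw.1
  have hC0 : 0 < C := by linarith
  have hRR : R * R = t * Real.log t := Real.mul_self_sqrt (by positivity)
  have hR0 : 0 < R := Real.sqrt_pos.2 (by positivity)
  have hℓpos : 0 < Real.log (2 / w) :=
    Real.log_pos (by rw [lt_div_iff₀ hw.1]; linarith [hw.2])
  have hwZ : w * Z = R * Real.log (2 / w) := by
    rw [div_eq_div_iff hℓpos.ne' hZ.ne'] at hwx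
    exact hwx
  -- As `log C ≥ 1`, passing from `ε = C w` to `w` absorbs the `+ 1` allowed for rounding the level.
  have hℓ : Real.log (2 / (C * w)) + Real.log C = Real.log (2 / w) := by
    rw [← Real.log_mul (by positivity) (by positivity)]
    congr 1
    field_simp
  have hlogC : 1 ≤ Real.log C := one_le_log_of_three_le (by linarith)
  have hlam : 0 < Real.log (2 / (C * w)) := Real.log_pos (by
    rw [lt_div_iff₀ (by positivity)]; linarith)
  have hnℓ : (n : ℝ) ≤ Real.log (2 / w) := by linarith
  constructor
  · have hwt : 1 ≤ w * t := by
      have h1 : R ≤ w * t := by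
        calc R ≤ R * Real.log (2 / w) := le_mul_of_one_le_right hR0.le (by linarith)
          _ = w * Z := hwZ.symm
          _ ≤ w * t := by gcongr
      have : 1 ≤ R * R := by rw [hRR]; nlinarith
      nlinarith
    have h1 : Real.log (2 / (C * w)) ≤ 2 / (C * w) := by
      have := Real.log_le_sub_one_of_pos (show 0 < 2 / (C * w) by positivity)
      linarith
    have h2 : 2 / (C * w) ≤ t := by
      rw [div_le_iff₀ (by positivity)]
      nlinarith
    have : (n : ℝ) < t + 1 := by linarith
    exact Nat.lt_succ_iff.1 (by exact_mod_cast this)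
  -- The equation of `w` reads `w Z = R log (2 / w)`; `C ≥ 32` turns `4 w` into at most `ε / 8`.
  · calc 4 * n * R = 4 * (R * n) := by ring
      _ ≤ 4 * (R * Real.log (2 / w)) := by gcongr
      _ = 4 * (w * Z) := by rw [hwZ]
      _ = 32 * w / 8 * Z := by ring
      _ ≤ C * w / 8 * Z := by gcongr

theorem abs_sum_sub_sum_lt (hgood : h ∉ E.deviationEvent i t) {n : ℕ} (h1 : 1 ≤ n) (hn : n ≤ t) :
    |∑ s ∈ Finset.range t, E.clippedGain i n (h s) -
      ∑ s ∈ Finset.range t, E.clippedMean i n (h s).1| < 4 * n * √(t * Real.log t) := by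
  by_contra! hc
  refine hgood ⟨n, Finset.mem_Icc.2 ⟨h1, hn⟩, ?_⟩
  rwa [deviation, Finset.sum_sub_distrib]

theorem estimate_le (hC : 32 ≤ C) (ht : 2 ≤ t) (hy : ∀ s, (h s).2.2.2 ∈ Set.Icc (0 : ℝ) 1)
    (hgood : h ∉ E.deviationEvent i t) (hε : E.eps C i t h < 1) :
    E.estimate C i t h ≤ E.mean i + E.eps C i t h := by
  have hZ := E.normalizer_pos i (show 0 < t by omega) h
  have hε0 := eps_pos (E := E) hC i ht h
  have hlam : 0 < Real.log (2 / E.eps C i t h) := Real.log_pos (by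
    rw [lt_div_iff₀ hε0]; linarith)
  -- Rounding up can only increase the gains, while the mean at any level stays below `μ_i`.
  set n := ⌈Real.log (2 / E.eps C i t h)⌉₊
  obtain ⟨hnt, hdev⟩ := level_le hC ht hε (Nat.ceil_lt_add_one hlam.le)
  have habs := (abs_lt.1 (abs_sum_sub_sum_lt hgood (Nat.ceil_pos.2 hlam) hnt)).2
  have hmono : ∑ s ∈ Finset.range t, E.clippedGain i (Real.log (2 / E.eps C i t h)) (h s) ≤
      ∑ s ∈ Finset.range t, E.clippedGain i n (h s) :=
    Finset.sum_le_sum fun s _ => E.clippedGain_mono i (Nat.le_ceil _) _ (hy s).1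
  have hmean : ∑ s ∈ Finset.range t, E.clippedMean i n (h s).1 ≤
      E.mean i * E.normalizer i t h := by
    rw [normalizer, Finset.mul_sum]
    exact Finset.sum_le_sum fun s _ => E.clippedMean_le i n _
  rw [estimate_eq hε0, one_div, ← div_eq_inv_mul, div_le_iff₀ hZ]
  nlinarith [mul_pos hε0 hZ]

/-- For `ε ≥ 2/3` the bonus alone is at least `1`. Otherwise rounding the level down leaves bias at
most `ε` and deviation at most `ε / 8`, both covered by `3 ε / 2`. -/
theorem mean_le_ucb (hC : 32 ≤ C) (ht : 2 ≤ t) (hy : ∀ s, (h s).2.2.2 ∈ Set.Icc (0 : ℝ) 1)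
    (hgood : h ∉ E.deviationEvent i t) : E.mean i ≤ E.ucb C i t h := by
  have hZ := E.normalizer_pos i (show 0 < t by omega) h
  have hε0 := eps_pos (E := E) hC i ht h
  unfold ucb
  rcases le_or_gt (2 / 3) (E.eps C i t h) with hε | hε
  · linarith [E.mean_le_one i, estimate_nonneg hε0 hy]
  have hlam : 1 ≤ Real.log (2 / E.eps C i t h) := one_le_log_of_three_le (by
    rw [le_div_iff₀ hε0]; linarith)
  have hfloor : (⌊Real.log (2 / E.eps C i t h)⌋₊ : ℝ) ≤ Real.log (2 / E.eps C i t h) :=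
    Nat.floor_le (by linarith)
  have hfloor' := Nat.lt_floor_add_one (Real.log (2 / E.eps C i t h))
  have hn1 : 1 ≤ ⌊Real.log (2 / E.eps C i t h)⌋₊ := Nat.le_floor (by simpa using hlam)
  set n := ⌊Real.log (2 / E.eps C i t h)⌋₊
  obtain ⟨hnt, hdev⟩ := level_le (n := n) hC ht (by linarith) (by linarith)
  have habs := (abs_lt.1 (abs_sum_sub_sum_lt hgood hn1 hnt)).1
  have hmono : ∑ s ∈ Finset.range t, E.clippedGain i n (h s) ≤
      ∑ s ∈ Finset.range t, E.clippedGain i (Real.log (2 / E.eps C i t h)) (h s) :=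
    Finset.sum_le_sum fun s _ => E.clippedGain_mono i hfloor _ (hy s).1
  have hmean : (E.mean i - Real.exp (-(n : ℝ)) / 2) * E.normalizer i t h ≤
      ∑ s ∈ Finset.range t, E.clippedMean i n (h s).1 := by
    rw [normalizer, Finset.mul_sum]
    exact Finset.sum_le_sum fun s _ => E.le_clippedMean i (by exact_mod_cast hn1) _
  -- Rounding down costs a factor `e` in the bias: `e · ε / 2 ≤ 2 ε`.
  have hexp : Real.exp (-(n : ℝ)) ≤ 2 * E.eps C i t h := by
    calc Real.exp (-(n : ℝ)) ≤ Real.exp (1 - Real.log (2 / E.eps C i t h)) :=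
          Real.exp_le_exp.2 (by linarith)
      _ = Real.exp 1 * (E.eps C i t h / 2) := by
          rw [Real.exp_sub, Real.exp_log (by positivity)]
          field_simp
      _ ≤ 4 * (E.eps C i t h / 2) := by
          gcongr
          linarith [Real.exp_one_lt_d9]
      _ = _ := by ring
  have hest : (E.mean i - E.eps C i t h - E.eps C i t h / 8) ≤ E.estimate C i t h := by
    rw [estimate_eq hε0, one_div, ← div_eq_inv_mul, le_div_iff₀ hZ]
    have : (E.mean i - E.eps C i t h) * E.normalizer i t h ≤
        (E.mean i - Real.exp (-(n : ℝ)) / 2) * E.normalizer i t h := by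
      gcongr
      linarith
    nlinarith
  linarith

/-- By monotonicity of `w` it is enough to test its defining equation at `y = Δ / (3C)`. With `Z ≥ t
/ M` and after squaring, this is exactly the condition in `tauSub`. -/
theorem eps_le_gap_div_three {M γ : ℝ} (hC : 32 ≤ C) (hM : ∀ i j, E.logDiv i j ≤ M)
    (hΔ : 0 < E.gap i) (hΔ1 : E.gap i ≤ 1) (ht : E.burnIn C M γ i ≤ t) :
    E.eps C i t h ≤ E.gap i / 3 := by
  have hM1 : 1 ≤ M := (E.one_le_logDiv i i).trans (hM i i)
  obtain ⟨h3, hB⟩ := tauSub_spec hC hM1 hΔ hΔ1 ((le_max_right _ _).trans ht)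
  have ht' : (3 : ℝ) ≤ t := by exact_mod_cast h3
  have hlog : 0 < Real.log t := Real.log_pos (by linarith)
  have hC0 : 0 < C := by linarith
  have hM0 : 0 < M := by linarith
  set Δ := E.gap i
  have hK : 1 ≤ Real.log (6 * C / Δ) := one_le_log_of_three_le (by
    rw [le_div_iff₀ hΔ]; nlinarith)
  have hy : Δ / (3 * C) ∈ Set.Ioo (0 : ℝ) 2 := by
    refine ⟨by positivity, ?_⟩
    rw [div_lt_iff₀ (by positivity)]
    linarith
  have hx : √(t * Real.log t) / E.normalizer i t h ≤
      Δ / (3 * C) / Real.log (2 / (Δ / (3 * C))) := by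
    rw [show 2 / (Δ / (3 * C)) = 6 * C / Δ by field_simp; norm_num]
    set K := Real.log (6 * C / Δ)
    have hZ := E.div_le_normalizer hM i t h
    refine (div_le_div_of_nonneg_left (Real.sqrt_nonneg _) (by positivity) hZ).trans ?_
    rw [div_div, div_le_div_iff₀ (by positivity) (by positivity), mul_div_assoc']
    rw [le_div_iff₀ hM0]
    refine le_of_sq_le_sq ?_ (by positivity)
    rw [div_le_div_iff₀ (by positivity) hlog] at hB
    have hRR : √(t * Real.log t) ^ 2 = t * Real.log t := Real.sq_sqrt (by positivity)
    calc (√(t * Real.log t) * (3 * C * K) * M) ^ 2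
        = √(t * Real.log t) ^ 2 * (9 * C ^ 2 * M ^ 2 * K ^ 2) := by ring
      _ = t * (9 * C ^ 2 * M ^ 2 * K ^ 2 * Real.log t) := by rw [hRR]; ring
      _ ≤ t * (t * Δ ^ 2) := by gcongr
      _ = (Δ * t) ^ 2 := by ring
  have := clipW_le (sqrt_div_normalizer_pos i (by omega) h) hy hx
  calc E.eps C i t h ≤ C * (Δ / (3 * C)) := mul_le_mul_of_nonneg_left this hC0.le
    _ = Δ / 3 := by field_simp

theorem three_le_burnIn {M γ : ℝ} (hC : 32 ≤ C) (hM : ∀ i j, E.logDiv i j ≤ M)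
    (hΔ : 0 < E.gap i) (hΔ1 : E.gap i ≤ 1) : 3 ≤ E.burnIn C M γ i :=
  (tauSub_spec hC ((E.one_le_logDiv i i).trans (hM i i)) hΔ hΔ1 (le_max_right _ _)).1

/-- The index is at most `μ_i + 5 ε / 2`, and `5/2 · Δ/3 < Δ`. -/
theorem ucb_lt_bestMean {M γ : ℝ} (hC : 32 ≤ C) (hM : ∀ i j, E.logDiv i j ≤ M)
    (hΔ : 0 < E.gap i) (hΔ1 : E.gap i ≤ 1) (ht : E.burnIn C M γ i ≤ t)
    (hy : ∀ s, (h s).2.2.2 ∈ Set.Icc (0 : ℝ) 1) (hgood : h ∉ E.deviationEvent i t) :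
    E.ucb C i t h < E.bestMean := by
  have hε := eps_le_gap_div_three (h := h) hC hM hΔ hΔ1 ht
  have hM1 : 1 ≤ M := (E.one_le_logDiv i i).trans (hM i i)
  have h3 := (tauSub_spec hC hM1 hΔ hΔ1 ((le_max_right _ _).trans ht)).1
  have := estimate_le hC (by omega) hy hgood (by linarith)
  have hg : E.gap i = E.bestMean - E.mean i := rfl
  unfold ucb
  linarith

end Trajectory

/-! ### Probability of a wrong choice and expected regret -/

section Run

variable [MeasurableSpace 𝒳] [MeasurableSpace 𝒱]
  [DiscreteMeasurableSpace 𝒳] [DiscreteMeasurableSpace 𝒱]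
  {M γ C : ℝ} {Ω : Type*} [MeasurableSpace Ω] {P : Measure Ω} [IsProbabilityMeasure P]
  {H : ℕ → Ω → Round N 𝒳 𝒱}

theorem IsDUCBRun.measureReal_ucb_lt (hH : E.IsDUCBRun C P H) (hC : 32 ≤ C)
    (hM : ∀ i j, E.logDiv i j ≤ M) {k : Fin N} (hΔ : 0 < E.gap k) (hΔ1 : E.gap k ≤ 1) {t : ℕ}
    (ht : E.burnIn C M γ k ≤ t) :
    1 - 1 / (t : ℝ) ^ 2 ≤ P.real {ω | E.ucb C k t (fun s => H s ω) < E.bestMean} := by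
  have h2 : 2 ≤ t := by have := three_le_burnIn (γ := γ) hC hM hΔ hΔ1; omega
  have hbad : P.real {ω | (fun s => H s ω) ∈ E.deviationEvent k t} ≤ 1 / (t : ℝ) ^ 2 :=
    ENNReal.toReal_le_of_le_ofReal (by positivity) (hH.measure_deviationEvent_le k h2)
  have hc := probReal_compl_eq_one_sub (μ := P) (hH.measurableSet_deviationEvent k t)
  have hle : P.real {ω | (fun s => H s ω) ∈ E.deviationEvent k t}ᶜ ≤
      P.real {ω | E.ucb C k t (fun s => H s ω) < E.bestMean} := by
    -- Only the deviation event needs to be measurable; the index event enters through monotonicity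
    -- alone.
    refine ENNReal.toReal_mono (measure_ne_top _ _) (measure_mono_ae ?_)
    filter_upwards [hH.ae_reward_mem_Icc] with ω hω hgood
    exact ucb_lt_bestMean hC hM hΔ hΔ1 ht hω hgood
  linarith

/-- After the burn-in, a suboptimal expert is played with probability at most `2 / t ^ 2`. -/
theorem IsDUCBRun.measureReal_choice_le (hH : E.IsDUCBRun C P H) (hC : 32 ≤ C)
    (hM : ∀ i j, E.logDiv i j ≤ M) {k : Fin N} (hΔ : 0 < E.gap k) (hΔ1 : E.gap k ≤ 1) {t : ℕ}
    (ht : E.burnIn C M γ k ≤ t) : P.real {ω | (H t ω).1 = k} ≤ 2 * (1 / (t : ℝ) ^ 2) := by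
  have h2 : 2 ≤ t := by have := three_le_burnIn (γ := γ) hC hM hΔ hΔ1; omega
  have : Nonempty (Fin N) := ⟨k⟩
  obtain ⟨b, hb⟩ := E.exists_mean_eq_bestMean
  have hbad : ∀ i, P.real {ω | (fun s => H s ω) ∈ E.deviationEvent i t} ≤ 1 / (t : ℝ) ^ 2 :=
    fun i => ENNReal.toReal_le_of_le_ofReal (by positivity) (hH.measure_deviationEvent_le i h2)
  calc P.real {ω | (H t ω).1 = k}
      ≤ P.real ({ω | (fun s => H s ω) ∈ E.deviationEvent k t} ∪
          {ω | (fun s => H s ω) ∈ E.deviationEvent b t}) := by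
        refine ENNReal.toReal_mono (measure_ne_top _ _) (measure_mono_ae ?_)
        filter_upwards [hH.ae_reward_mem_Icc, hH.choice t (by omega)] with ω hω hch hk
        have hk : (H t ω).1 = k := hk
        by_contra hn
        obtain ⟨hn1, hn2⟩ := not_or.1 hn
        have l1 := ucb_lt_bestMean hC hM hΔ hΔ1 ht hω hn1
        have l2 := mean_le_ucb hC h2 hω hn2
        have l3 := hch b
        rw [hk] at l3
        linarith
    _ ≤ _ := measureReal_union_le _ _
    _ ≤ _ := by linarith [hbad k, hbad b]

theorem IsDUCBRun.sum_measureReal_choice_le (hH : E.IsDUCBRun C P H) (hC : 32 ≤ C)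
    (hM : ∀ i j, E.logDiv i j ≤ M) {k : Fin N} (hΔ : 0 < E.gap k) (hΔ1 : E.gap k ≤ 1) (T : ℕ) :
    ∑ t ∈ Finset.range T, P.real {ω | (H t ω).1 = k} ≤
      E.burnIn C M γ k + Real.pi ^ 2 / 3 := by
  set τ := E.burnIn C M γ k with hτ
  have h1 : ∀ t ∈ Finset.range T, P.real {ω | (H t ω).1 = k} ≤
      (if t < τ then 1 else 0) + 2 * (1 / (t : ℝ) ^ 2) := by
    intro t _
    split_ifs with h
    · have : P.real {ω | (H t ω).1 = k} ≤ 1 := measureReal_le_one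
      have : 0 ≤ 2 * (1 / (t : ℝ) ^ 2) := by positivity
      linarith
    · rw [zero_add]
      exact hH.measureReal_choice_le hC hM hΔ hΔ1 (not_lt.1 h)
  refine (Finset.sum_le_sum h1).trans ?_
  rw [Finset.sum_add_distrib, ← Finset.mul_sum]
  have h2 : ∑ t ∈ Finset.range T, (if t < τ then (1 : ℝ) else 0) ≤ τ := by
    rw [Finset.sum_boole]
    have : {t ∈ Finset.range T | t < τ} ⊆ Finset.range τ := fun t ht =>
      Finset.mem_range.2 (Finset.mem_filter.1 ht).2
    have := Finset.card_le_card this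
    rw [Finset.card_range] at this
    exact_mod_cast this
  -- Twice `ζ(2)` is `π² / 3`; the term `t = 0` is `0` by the convention `1 / 0 = 0`.
  have h3 := sum_le_hasSum (Finset.range T) (fun t _ => by positivity) hasSum_zeta_two
  linarith

theorem IsDUCBRun.integral_regret_eq (hH : E.IsDUCBRun C P H) (T : ℕ) :
    ∫ ω, E.regret T (fun s => H s ω) ∂P =
      ∑ k, E.gap k * ∑ t ∈ Finset.range T, P.real {ω | (H t ω).1 = k} := by
  have hm : ∀ t k, MeasurableSet {ω | (H t ω).1 = k} := fun t k =>
    (hH.measurable t).fst (measurableSet_singleton k)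
  have e : ∀ ω, E.regret T (fun s => H s ω) = ∑ t ∈ Finset.range T, ∑ k,
      {ω | (H t ω).1 = k}.indicator (fun _ => E.gap k) ω := by
    intro ω
    refine Finset.sum_congr rfl fun t _ => ?_
    simp [Set.indicator_apply, gap]
  have hi : ∀ t k, Integrable ({ω | (H t ω).1 = k}.indicator fun _ => E.gap k) P :=
    fun t k => (integrable_const _).indicator (hm t k)
  simp_rw [e]
  rw [integral_finsetSum _ fun t _ => integrable_finsetSum _ fun k _ => hi t k]
  simp_rw [integral_finsetSum _ fun k _ => hi _ k, integral_indicator_const _ (hm _ _),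
    Finset.mul_sum, smul_eq_mul, mul_comm]
  exact Finset.sum_comm

end Run
end ExpertBandit

theorem mainTheorem6 {N : ℕ} {𝒳 𝒱 : Type*} [Fintype 𝒳] [Fintype 𝒱]
    [MeasurableSpace 𝒳] [DiscreteMeasurableSpace 𝒳]
    [MeasurableSpace 𝒱] [DiscreteMeasurableSpace 𝒱]
    (E : ExpertBandit N 𝒳 𝒱) (M γ C : ℝ)
    (hM : ∀ i j, E.logDiv i j ≤ M)
    (hγ : 0 < γ) (hγmean : ∀ i, γ ≤ E.mean i)
    (hC : 32 * M / γ ≤ C)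
    {Ω : Type*} [MeasurableSpace Ω] (P : Measure Ω) [IsProbabilityMeasure P]
    (H : ℕ → Ω → Round N 𝒳 𝒱) (hH : E.IsDUCBRun C P H) :
    (∀ k : Fin N, E.mean k < E.bestMean → ∀ t : ℕ, E.burnIn C M γ k ≤ t →
      1 - 1 / (t : ℝ) ^ 2 ≤ P.real {ω | E.ucb C k t (fun s => H s ω) < E.bestMean}) ∧
    (∀ T : ℕ, ∫ ω, E.regret T (fun s => H s ω) ∂P
      ≤ ∑ k with E.mean k < E.bestMean,
          E.gap k * (E.burnIn C M γ k + Real.pi ^ 2 / 3)) ∧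
    (∀ T : ℕ, ∫ ω, E.regret T (fun s => H s ω) ∂P ≤ E.regretConst C M γ * N) := by
  -- Follows from `γ ≤ μ_k ≤ 1 ≤ M`, which needs some expert `k`; for `N = 0` nothing bounds `γ`.
  have hC32 : ∀ _ : Fin N, 32 ≤ C := fun k => by
    refine le_trans ?_ hC
    rw [le_div_iff₀ hγ]
    linarith [hγmean k, E.mean_le_one k, (E.one_le_logDiv k k).trans (hM k k)]
  have hgap : ∀ k, E.mean k < E.bestMean → 0 < E.gap k := fun k hk => sub_pos.2 hk
  have hgap1 : ∀ k, E.gap k ≤ 1 := fun k => by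
    have : Nonempty (Fin N) := ⟨k⟩
    obtain ⟨b, hb⟩ := E.exists_mean_eq_bestMean
    have hg : E.gap k = E.bestMean - E.mean k := rfl
    linarith [E.mean_le_one b, hγmean k]
  have hreg : ∀ T : ℕ, ∫ ω, E.regret T (fun s => H s ω) ∂P
      ≤ ∑ k with E.mean k < E.bestMean, E.gap k * (E.burnIn C M γ k + Real.pi ^ 2 / 3) := by
    intro T
    rw [hH.integral_regret_eq T, Finset.sum_filter]
    refine Finset.sum_le_sum fun k _ => ?_
    split_ifs with hk
    · exact mul_le_mul_of_nonneg_left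
        (hH.sum_measureReal_choice_le (hC32 k) hM (hgap k hk) (hgap1 k) T) (E.gap_nonneg k)
    · rw [show E.gap k = 0 from le_antisymm (sub_nonpos.2 (not_lt.1 hk)) (E.gap_nonneg k),
        zero_mul]
  refine ⟨fun k hk t ht => hH.measureReal_ucb_lt (hC32 k) hM (hgap k hk) (hgap1 k) ht, hreg,
    fun T => (hreg T).trans ?_⟩
  have hnn : ∀ k, 0 ≤ E.gap k * (E.burnIn C M γ k + Real.pi ^ 2 / 3) := fun k =>
    mul_nonneg (E.gap_nonneg k) (by positivity)
  calc _ ≤ ∑ k, E.gap k * (E.burnIn C M γ k + Real.pi ^ 2 / 3) :=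
        Finset.sum_le_sum_of_subset_of_nonneg (Finset.filter_subset _ _) fun k _ _ => hnn k
    _ ≤ ∑ _k : Fin N, E.regretConst C M γ := Finset.sum_le_sum fun k _ =>
        le_ciSup (f := fun k => E.gap k * (E.burnIn C M γ k + Real.pi ^ 2 / 3))
          (Set.finite_range _).bddAbove k
    _ = _ := by simp [mul_comm]
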